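/- For an invertible measure preserving transformation $T$ of a probability space $(X,\mathcal B,\mu)$, a function $f\in L^1(\mu)$ with $f\ge 0$, an integer $n\ge 1$ and $x\in X$, put $$\mathbf N_n(f)(x)=\#\left\{k\ge 1:\ \frac{f(T^kx)}{k}>\frac1n\right\}\in\{0,1,2,\dots\}\cup\{\infty\}.$$ Then $$\sup_{(X,\mathcal B,\mu,T)}\ \sup_{f\ge 0,\ \|f\|_1=1}\ \sup_{\lambda>0}\ \lambda\cdot\mu\left\{x:\ \sup_{n\ge 1}\frac{\mathbf N_n(f)(x)}{n}>\lambda\right\}=\infty,$$ where the first supremum is over all such probability spaces and transformations $T$; that is, the counting maximal operator $f\mapsto\sup_n \mathbf N_n(f)/n$ satisfies no weak type $(1,1)$ inequality uniformly over measure preserving systems. Moreover, the supremum is already infinite when the systems are restricted to the dyadic rotations $x\mapsto x+2^{-J}$ mod $1$, $J=0,1,2,\dots$, of $[0,1)$ with Lebesgue measure. -/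

import Mathlib

open MeasureTheory
open scoped ENNReal NNReal

noncomputable section

namespace CountingProblem

/-- `N_n(f)(x) = #{k ≥ 1 : f (T^k x) / k > 1 / n}`, a possibly infinite cardinality. -/
def count {X : Type*} (T : X → X) (f : X → ℝ) (n : ℕ) (x : X) : ℕ∞ :=
  Set.encard {k : ℕ | 1 ≤ k ∧ f (T^[k] x) / (k : ℝ) > 1 / (n : ℝ)}

/-- The counting maximal function `sup_{n ≥ 1} N_n(f)(x) / n`. -/
def maximalCount {X : Type*} (T : X → X) (f : X → ℝ) (x : X) : ℝ≥0∞ :=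
  ⨆ (n : ℕ) (_ : 1 ≤ n), (count T f n x : ℝ≥0∞) / (n : ℝ≥0∞)

/-- The best constant in the weak type (1,1) inequality for the counting maximal function of one
system: the supremum of `lam * μ {x | sup_n N_n(f)(x) / n > lam}` over all `lam > 0` and all
nonnegative `f` in `L¹(μ)` of norm one. -/
def weakTypeConst {X : Type*} [MeasurableSpace X] (μ : Measure X) (T : X → X) : ℝ≥0∞ :=
  ⨆ (f : X → ℝ) (_ : Integrable f μ) (_ : 0 ≤ᵐ[μ] f) (_ : eLpNorm f 1 μ = 1)
    (lam : ℝ≥0) (_ : 0 < lam),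
    (lam : ℝ≥0∞) * μ {x | maximalCount T f x > (lam : ℝ≥0∞)}

/-- The dyadic rotation `x ↦ x + 2^{-J}` mod 1. -/
def dyadicRotation (J : ℕ) (x : UnitAddCircle) : UnitAddCircle :=
  x + (((2 : ℝ) ^ J)⁻¹ : ℝ)

end CountingProblem

end

/-!
It suffices to construct functions on `{0, …, 2 ^ L - 1}` with the shift `x ↦ x + 1`, since the
dyadic rotation permutes the `2 ^ L` intervals of length `2 ^ (-L)` in this way.

The idea is to let every point `x` choose, by means of its binary digits, a scale `s` at which many
levels contribute to the maximal function. Level `n` carries spikes of height about `2 ^ offset n`,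
which are marked by a label of `offset n` bits and by `M` further bits that must all be `1`. So each
level has mass `2 ^ (-M)`, and `K = 2 ^ (M + 2)` levels have bounded mass. The same `M` bits are
used to read off a depth `d ≤ M` from `x`, after which the scale is moved to just behind the `d`-th
of these bits: next to `x` and at that scale, the bits after the `d`-th one are already equal to
`1`, so that the density of spikes is larger than average by the factor `2 ^ (M - d)`. With `d` the
last position of a bit `0`, the mean of `2 ^ (-d)` is `2 ^ (-M) (1 + M / 2)`. Later levels
move the scale by so much smaller steps that they do not leave the range admissible for
the earlier ones, hence at the final scale all contributions `2 ^ (-d)` add up. By an exponential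
moment bound their sum is at least `1 + M / 2` for half of all points, while the mass stays bounded.
-/

namespace CountingProblem

open Finset
open scoped BigOperators

section Bits

variable {m : ℕ}

lemma testBit_two_pow_mul_add_of_lt {p : ℕ} (hp : p < m) (y D : ℕ) :
    (2 ^ m * y + D).testBit p = D.testBit p := by
  have h := Nat.testBit_mod_two_pow (2 ^ m * y + D) m p
  rw [Nat.mul_add_mod, Nat.testBit_mod_two_pow] at h
  simpa [hp] using h.symm

lemma testBit_congr_of_div_eq {x y p : ℕ} (h : x / 2 ^ m = y / 2 ^ m) (hp : m ≤ p) :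
    x.testBit p = y.testBit p := by
  obtain ⟨j, rfl⟩ := Nat.exists_eq_add_of_le' hp
  rw [← Nat.testBit_div_two_pow, ← Nat.testBit_div_two_pow, h]

lemma div_two_pow_congr {x y j : ℕ} (h : x / 2 ^ m = y / 2 ^ m) (hmj : m ≤ j) :
    x / 2 ^ j = y / 2 ^ j := by
  obtain ⟨i, rfl⟩ := Nat.exists_eq_add_of_le hmj
  rw [pow_add, ← Nat.div_div_eq_div_mul, ← Nat.div_div_eq_div_mul, h]

lemma lt_two_pow_of_div_eq {x y j : ℕ} (h : y / 2 ^ m = x / 2 ^ m) (hmj : m ≤ j)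
    (hx : x < 2 ^ j) : y < 2 ^ j := by
  have hdiv := div_two_pow_congr h hmj
  rw [Nat.div_eq_of_lt hx] at hdiv
  exact (Nat.div_eq_zero_iff_lt (Nat.two_pow_pos j)).1 hdiv

lemma two_pow_mul_add_div {D : ℕ} (hD : D < 2 ^ m) (y : ℕ) : (2 ^ m * y + D) / 2 ^ m = y := by
  rw [Nat.mul_add_div (by positivity), Nat.div_eq_of_lt hD, add_zero]

lemma expect_range_two_pow_add (m k : ℕ) (F : ℕ → ℝ) :
    𝔼 x ∈ range (2 ^ (m + k)), F x =
      𝔼 y ∈ range (2 ^ k), 𝔼 D ∈ range (2 ^ m), F (2 ^ m * y + D) := by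
  rw [← expect_product']
  refine expect_nbij' (fun x => (x / 2 ^ m, x % 2 ^ m)) (fun z => 2 ^ m * z.1 + z.2) ?_ ?_ ?_ ?_ ?_
  · intro x hx
    rw [mem_range, pow_add] at hx
    simpa [Nat.mod_lt] using Nat.div_lt_of_lt_mul hx
  · rintro ⟨y, D⟩ hz
    simp only [mem_product, mem_range] at hz ⊢
    calc 2 ^ m * y + D < 2 ^ m * (y + 1) := by rw [mul_add_one]; omega
      _ ≤ 2 ^ m * 2 ^ k := Nat.mul_le_mul_left _ hz.1
      _ = 2 ^ (m + k) := (pow_add ..).symm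
  · exact fun x _ => Nat.div_add_mod ..
  · rintro ⟨y, D⟩ hz
    have hD : D < 2 ^ m := by simpa using (mem_product.1 hz).2
    simp [two_pow_mul_add_div hD, Nat.mod_eq_of_lt hD]
  · exact fun x _ => by rw [Nat.div_add_mod]

lemma card_filter_testBit_mul {T : Finset ℕ} (hT : T ⊆ range m) (g : ℕ → Bool) :
    #{x ∈ range (2 ^ m) | ∀ p ∈ T, x.testBit p = g p} * 2 ^ #T = 2 ^ m := by
  induction T using Finset.induction_on with
  | empty => simp
  | insert p T hp ih =>
    obtain ⟨hpm, hTm⟩ := insert_subset_iff.1 hT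
    set A := {x ∈ range (2 ^ m) | ∀ p ∈ T, x.testBit p = g p}
    have hflip : #{x ∈ A | ¬ x.testBit p = g p} = #{x ∈ A | x.testBit p = g p} := by
      have hmem : ∀ x ∈ A, x ^^^ 2 ^ p ∈ A := by
        intro x hx
        simp only [A, mem_filter, mem_range] at hx ⊢
        refine ⟨Nat.xor_lt_two_pow hx.1
          (Nat.pow_lt_pow_right one_lt_two (mem_range.1 hpm)), fun r hr => ?_⟩
        rw [Nat.testBit_xor, Nat.testBit_two_pow_of_ne (by rintro rfl; exact hp hr),
          Bool.xor_false, hx.2 r hr]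
      refine card_nbij' (· ^^^ 2 ^ p) (· ^^^ 2 ^ p) ?_ ?_ ?_ ?_
      all_goals intro x hx
      all_goals simp only [coe_filter, Set.mem_ofPred_eq] at hx ⊢
      · refine ⟨hmem x hx.1, ?_⟩
        simpa [Nat.testBit_xor, Nat.testBit_two_pow_self, ← Bool.eq_not] using hx.2
      · refine ⟨hmem x hx.1, ?_⟩
        simpa [Nat.testBit_xor, Nat.testBit_two_pow_self] using hx.2
      all_goals rw [Nat.xor_assoc, Nat.xor_self, Nat.xor_zero]
    have hsplit := card_filter_add_card_filter_not (s := A) (fun x => x.testBit p = g p)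
    have hfilter : {x ∈ range (2 ^ m) | ∀ r ∈ insert p T, x.testBit r = g r} =
        {x ∈ A | x.testBit p = g p} := by
      ext x
      simp only [A, mem_filter, forall_mem_insert]
      tauto
    rw [hfilter, card_insert_of_notMem hp, ← ih hTm, ← hsplit, hflip]
    ring

lemma expect_testBit_eq {T : Finset ℕ} (hT : T ⊆ range m) (g : ℕ → Bool) :
    𝔼 x ∈ range (2 ^ m), (if ∀ p ∈ T, x.testBit p = g p then (1 : ℝ) else 0) = (1 / 2) ^ #T := by
  have h : (#{x ∈ range (2 ^ m) | ∀ p ∈ T, x.testBit p = g p} : ℝ) * 2 ^ #T = 2 ^ m := by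
    exact_mod_cast card_filter_testBit_mul hT g
  rw [expect_eq_sum_div_card, sum_boole, card_range, div_eq_iff (by positivity), Nat.cast_pow,
    Nat.cast_ofNat, ← h, one_div, inv_pow]
  field_simp

lemma expect_mod_eq_and_testBit {o r : ℕ} (ho : o ≤ m) (hr : r < 2 ^ o) {S : Finset ℕ}
    (hS : S ⊆ Ico o m) :
    𝔼 x ∈ range (2 ^ m), (if x % 2 ^ o = r ∧ ∀ p ∈ S, x.testBit p then (1 : ℝ) else 0) =
      (1 / 2) ^ (o + #S) := by
  have hlow : ∀ p ∈ S, ¬ p < o := fun p hp => not_lt.2 (mem_Ico.1 (hS hp)).1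
  have hdisj : Disjoint (range o) S :=
    disjoint_left.2 fun p hp hpS => hlow p hpS (mem_range.1 hp)
  have hsub : range o ∪ S ⊆ range m :=
    union_subset (range_subset_range.2 ho) fun p hp => mem_range.2 (mem_Ico.1 (hS hp)).2
  have hmod : ∀ x, x % 2 ^ o = r ↔ ∀ p ∈ range o, x.testBit p = r.testBit p := by
    intro x
    rw [← Nat.mod_eq_of_lt hr]
    refine ⟨fun h p hp => ?_, fun h => Nat.eq_of_testBit_eq fun p => ?_⟩
    · have := congrArg (Nat.testBit · p) h
      simpa [mem_range.1 hp] using this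
    · simp only [Nat.testBit_mod_two_pow]
      by_cases hp : p < o
      · simpa [hp] using h p (mem_range.2 hp)
      · simp [hp]
  have h := expect_testBit_eq hsub fun p => if p < o then r.testBit p else true
  rw [card_union_of_disjoint hdisj, card_range] at h
  rw [← h]
  refine expect_congr rfl fun x _ => if_congr ?_ rfl rfl
  rw [hmod, forall_mem_union]
  refine and_congr (forall₂_congr fun p hp => ?_) (forall₂_congr fun p hp => ?_)
  · rw [if_pos (mem_range.1 hp)]
  · rw [if_neg (hlow p hp)]

lemma card_filter_exists_window_le {v : ℕ} (hv : 4 * (m + 1) ≤ 2 ^ v) :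
    4 * #{x ∈ range (2 ^ m) | ∃ p ≤ m, p + v ≤ m ∧ ∀ j < v, x.testBit (p + j)} ≤ 2 ^ m := by
  set W : ℕ → Finset ℕ := fun p =>
    {x ∈ range (2 ^ m) | p + v ≤ m ∧ ∀ j < v, x.testBit (p + j)}
  have hW : ∀ p, #(W p) * 2 ^ v ≤ 2 ^ m := by
    intro p
    by_cases hp : p + v ≤ m
    · have hsub : Ico p (p + v) ⊆ range m := fun j hj =>
        mem_range.2 ((mem_Ico.1 hj).2.trans_le hp)
      rw [← card_filter_testBit_mul hsub fun _ => true, Nat.card_Ico, Nat.add_sub_cancel_left]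
      refine Nat.mul_le_mul_right _ (card_le_card (monotone_filter_right _ fun x _ hx j hj => ?_))
      obtain ⟨i, rfl⟩ := Nat.exists_eq_add_of_le (mem_Ico.1 hj).1
      exact hx.2 i (by simpa using hj)
    · simp [W, hp]
  have hunion : {x ∈ range (2 ^ m) | ∃ p ≤ m, p + v ≤ m ∧ ∀ j < v, x.testBit (p + j)} =
      (range (m + 1)).biUnion W := by
    ext x
    simp only [W, mem_filter, mem_biUnion, mem_range, Nat.lt_succ_iff]
    exact ⟨fun ⟨hx, p, hp, h⟩ => ⟨p, hp, hx, h⟩, fun ⟨p, hp, hx, h⟩ => ⟨hx, p, hp, h⟩⟩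
  refine Nat.le_of_mul_le_mul_right ?_ (Nat.two_pow_pos v)
  calc 4 * #{x ∈ range (2 ^ m) | ∃ p ≤ m, p + v ≤ m ∧ ∀ j < v, x.testBit (p + j)} * 2 ^ v
      ≤ 4 * (∑ p ∈ range (m + 1), #(W p)) * 2 ^ v := by rw [hunion]; gcongr; exact card_biUnion_le
    _ = 4 * ∑ p ∈ range (m + 1), #(W p) * 2 ^ v := by rw [mul_assoc, sum_mul]
    _ ≤ 4 * ∑ p ∈ range (m + 1), 2 ^ m := by gcongr; exact hW _
    _ = 4 * (m + 1) * 2 ^ m := by simp [mul_assoc]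
    _ ≤ 2 ^ m * 2 ^ v := by rw [mul_comm]; gcongr

lemma card_image_add_mul {u : ℕ} (hu : 0 < u) (p : ℕ) (A : Finset ℕ) :
    #(A.image fun a => p + a * u) = #A :=
  card_image_of_injective A fun _ _ h => Nat.eq_of_mul_eq_mul_right hu (Nat.add_left_cancel h)

lemma succ_div_two_pow_of_testBit_eq_false {v X j : ℕ} (hj : j < v) (h : X.testBit j = false) :
    (X + 1) / 2 ^ v = X / 2 ^ v := by
  refine Nat.succ_div_of_not_dvd fun hdvd => ?_
  have hmod : X % 2 ^ v = 2 ^ v - 1 := by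
    have hlt := Nat.mod_lt X (Nat.two_pow_pos v)
    have hdvd' : 2 ^ v ∣ X % 2 ^ v + 1 := by
      rwa [Nat.dvd_iff_mod_eq_zero, Nat.mod_add_mod, ← Nat.dvd_iff_mod_eq_zero]
    have hle := Nat.le_of_dvd (Nat.succ_pos _) hdvd'
    omega
  have hbit := Nat.testBit_mod_two_pow X v j
  simp [hmod, hj, h] at hbit

lemma next_interval_div_two_pow {v x E : ℕ} (hE : E < 2 ^ m)
    (h : ∃ j < v, x.testBit (m + j) = false) :
    (2 ^ m * (x / 2 ^ m + 1) + E) / 2 ^ (m + v) = x / 2 ^ (m + v) := by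
  obtain ⟨j, hj, hbit⟩ := h
  rw [add_comm m j, ← Nat.testBit_div_two_pow] at hbit
  rw [pow_add, ← Nat.div_div_eq_div_mul, ← Nat.div_div_eq_div_mul, two_pow_mul_add_div hE,
    succ_div_two_pow_of_testBit_eq_false hj hbit]

end Bits

section LastZero

variable {M p u x : ℕ}

/-- The last `a ≤ M` such that the bit of `x` at the place `p + a * u` is `0`, and `0` if there is
no such `a`. For random bits it is the number of steps by which a scale is increased. -/
def lastZero (M p u x : ℕ) : ℕ := Nat.findGreatest (fun a => x.testBit (p + a * u) = false) M

lemma lastZero_le (M p u x : ℕ) : lastZero M p u x ≤ M := Nat.findGreatest_le _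

lemma lastZero_le_iff {a : ℕ} :
    lastZero M p u x ≤ a ↔ ∀ b ∈ Ioc a M, x.testBit (p + b * u) := by
  refine ⟨fun h b hb => ?_, fun h => ?_⟩
  · obtain ⟨hab, hbM⟩ := mem_Ioc.1 hb
    simpa using Nat.findGreatest_is_greatest (h.trans_lt hab) hbM
  · by_contra! ha
    have hzero := Nat.findGreatest_of_ne_zero (rfl : lastZero M p u x = _) (by omega)
    simp [h _ (mem_Ioc.2 ⟨ha, lastZero_le M p u x⟩)] at hzero

lemma testBit_of_lastZero_lt {a : ℕ} (ha : lastZero M p u x < a) (haM : a ≤ M) :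
    x.testBit (p + a * u) :=
  lastZero_le_iff.1 le_rfl a (mem_Ioc.2 ⟨ha, haM⟩)

lemma lastZero_congr {y : ℕ} (h : ∀ a ≤ M, x.testBit (p + a * u) = y.testBit (p + a * u)) :
    lastZero M p u x = lastZero M p u y :=
  eq_of_forall_ge_iff fun a => by
    rw [lastZero_le_iff, lastZero_le_iff]
    exact forall₂_congr fun b hb => by rw [h b (mem_Ioc.1 hb).2]

lemma half_pow_eq_add_sum_ite {d : ℕ} (hd : d ≤ M) :
    (1 / 2 : ℝ) ^ d = (1 / 2) ^ M + ∑ a ∈ range M, if d ≤ a then (1 / 2) ^ (a + 1) else 0 := by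
  induction M, hd using Nat.le_induction with
  | base => rw [sum_eq_zero fun a ha => if_neg (not_le.2 (mem_range.1 ha)), add_zero]
  | succ M hd ih =>
    rw [sum_range_succ, if_pos hd, ih]
    ring

/-- The value `a ≥ 1` is attained with probability `(1 / 2) ^ (M + 1 - a)`, so that all these values
contribute equally to the mean. This is where the factor `1 + M / 2` comes from. -/
lemma expect_half_pow_lastZero {m : ℕ} (hu : 0 < u) (hm : p + M * u < m) :
    𝔼 x ∈ range (2 ^ m), (1 / 2 : ℝ) ^ lastZero M p u x = (1 / 2) ^ M * (1 + M / 2) := by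
  have htail : ∀ a ∈ range M, 𝔼 x ∈ range (2 ^ m),
      (if lastZero M p u x ≤ a then (1 / 2 : ℝ) ^ (a + 1) else 0) = (1 / 2) ^ (M + 1) := by
    intro a ha
    have hsub : (Ioc a M).image (fun b => p + b * u) ⊆ range m := by
      refine image_subset_iff.2 fun b hb => mem_range.2 ?_
      have := Nat.mul_le_mul_right u (mem_Ioc.1 hb).2
      omega
    have h := expect_testBit_eq hsub fun _ => true
    rw [card_image_add_mul hu, Nat.card_Ioc] at h
    simp only [forall_mem_image, ← lastZero_le_iff] at h
    calc _ = (𝔼 x ∈ range (2 ^ m), if lastZero M p u x ≤ a then (1 : ℝ) else 0) *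
          (1 / 2) ^ (a + 1) := by simp only [expect_mul, ite_mul, one_mul, zero_mul]
      _ = _ := by
        rw [h, ← pow_add]
        congr 1
        have := mem_range.1 ha
        omega
  simp only [half_pow_eq_add_sum_ite (lastZero_le M p u _)]
  rw [expect_add_distrib, expect_const (by simp), expect_sum_comm, sum_congr rfl htail, sum_const,
    card_range, nsmul_eq_mul]
  ring

lemma exp_neg_le_one_sub_half {t : ℝ} (h0 : 0 ≤ t) (h1 : t ≤ 1) : Real.exp (-t) ≤ 1 - t / 2 := by
  have hquad := Real.quadratic_le_exp_of_nonneg h0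
  rw [Real.exp_neg, inv_le_comm₀ (Real.exp_pos _) (by linarith)]
  refine le_trans ?_ hquad
  rw [inv_le_iff_one_le_mul₀ (by linarith)]
  nlinarith [mul_nonneg h0 h0, mul_nonneg (mul_nonneg h0 h0) (sub_nonneg.2 h1)]

lemma expect_exp_neg_half_pow_lastZero_le {m : ℕ} (hu : 0 < u) (hm : p + M * u < m) :
    𝔼 x ∈ range (2 ^ m), Real.exp (-(1 / 2) ^ lastZero M p u x) ≤
      Real.exp (-((1 / 2) ^ M * (1 + M / 2) / 2)) := by
  calc 𝔼 x ∈ range (2 ^ m), Real.exp (-(1 / 2) ^ lastZero M p u x)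
      ≤ 𝔼 x ∈ range (2 ^ m), (1 - (1 / 2) ^ lastZero M p u x / 2) :=
        expect_le_expect fun x _ => exp_neg_le_one_sub_half (by positivity)
          (pow_le_one₀ (by norm_num) (by norm_num))
    _ = -((1 / 2) ^ M * (1 + M / 2) / 2) + 1 := by
        rw [expect_sub_distrib, expect_const (by simp), ← expect_div,
          expect_half_pow_lastZero hu hm]
        ring
    _ ≤ _ := Real.add_one_le_exp _

end LastZero

/-- The parameters of the construction of a function on `{0, …, 2 ^ L - 1}`: `M` is the largest
depth, `K` the number of levels, and `v` the number of places that a carry is not allowed to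
cross. -/
structure Scheme where
  M : ℕ
  K : ℕ
  v : ℕ

namespace Scheme

variable (S : Scheme) {n x y : ℕ}

/-- The distance between two candidates for the scale after level `n` has been read. The factor
`M + 1` between consecutive levels makes the candidates of later levels fit between those of
earlier ones. -/
def spacing (n : ℕ) : ℕ := (S.v + 1) * (S.M + 1) ^ (S.K - n)

/-- The number of binary places reserved for each level. -/
def blockLength : ℕ := S.spacing 0

/-- The lowest binary place of the block of level `n`. The blocks are arranged downwards from level
`0`, and the block below the last level `K - 1` only serves to label the levels. -/
def offset (n : ℕ) : ℕ := S.blockLength * (S.K - n)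

/-- The total number `L` of binary places. -/
def length : ℕ := S.blockLength * (S.K + 1)

/-- The scale of `x` after the levels below `n` have been read: level `n` reads off the bits of `x`
in its block how many steps of length `spacing (n + 1)` are added. -/
def scale (x : ℕ) : ℕ → ℕ
  | 0 => 0
  | n + 1 => scale x n +
      lastZero S.M (S.offset n + scale x n) (S.spacing (n + 1)) x * S.spacing (n + 1)

/-- The number of steps that level `n` adds to the scale of `x`. -/
def depth (x n : ℕ) : ℕ := lastZero S.M (S.offset n + S.scale x n) (S.spacing (n + 1)) x

/-- The total contribution of the levels below `n` to the maximal function at `x`, up to a constant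
factor: level `i` produces a proportion `(1 / 2) ^ depth` of large values. -/
noncomputable def gain (x n : ℕ) : ℝ := ∑ i ∈ range n, (1 / 2) ^ S.depth x i

/-- `y` is a spike of level `n` if it carries the label `n` in the places below the block of level
`n` and all bits that decide about the depth of level `n` are `1`. -/
def IsSpike (n y : ℕ) : Prop :=
  y % 2 ^ S.offset n = n ∧
    ∀ a ∈ Icc 1 S.M, y.testBit (S.offset n + S.scale y n + a * S.spacing (n + 1))

instance : DecidablePred (S.IsSpike n) := fun _ => inferInstanceAs (Decidable (_ ∧ _))

/-- The function whose large values are counted: it takes the value `2 ^ offset n` at the spikes of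
level `n`. -/
noncomputable def spikeSum (y : ℕ) : ℝ :=
  ∑ n ∈ range S.K, if S.IsSpike n y then 2 ^ S.offset n else 0

lemma spacing_pos (n : ℕ) : 0 < S.spacing n := by unfold spacing; positivity

lemma spacing_eq_mul (hn : n < S.K) : S.spacing n = (S.M + 1) * S.spacing (n + 1) := by
  obtain ⟨k, hk⟩ := Nat.exists_eq_add_of_lt hn
  rw [spacing, spacing, show S.K - n = k + 1 by omega, show S.K - (n + 1) = k by omega]
  ring

lemma spacing_K : S.spacing S.K = S.v + 1 := by simp [spacing]

lemma offset_eq_add (hn : n < S.K) : S.offset n = S.offset (n + 1) + S.blockLength := by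
  rw [offset, offset, ← Nat.mul_add_one]
  congr 1
  omega

lemma offset_antitone : Antitone S.offset := fun _ _ h =>
  Nat.mul_le_mul_left _ (Nat.sub_le_sub_left h _)

lemma offset_add_blockLength_add (hn : n ≤ S.K) :
    S.offset n + S.blockLength + S.blockLength * n = S.length := by
  rw [offset, length, ← Nat.mul_add_one, ← Nat.mul_add]
  congr 1
  omega

lemma offset_add_blockLength_le (hn : n ≤ S.K) : S.offset n + S.blockLength ≤ S.length :=
  (Nat.le_add_right _ _).trans_eq (S.offset_add_blockLength_add hn)

lemma scale_succ (x n : ℕ) :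
    S.scale x (n + 1) = S.scale x n + S.depth x n * S.spacing (n + 1) := rfl

lemma gain_succ (x n : ℕ) : S.gain x (n + 1) = S.gain x n + (1 / 2) ^ S.depth x n :=
  sum_range_succ _ _

lemma scale_mono (x : ℕ) : Monotone (S.scale x) :=
  monotone_nat_of_le_succ fun _ => Nat.le_add_right _ _

lemma scale_add_spacing_le {i : ℕ} (hi : i ≤ n) (hn : n ≤ S.K) :
    S.scale x n + S.spacing n ≤ S.scale x i + S.spacing i := by
  induction n, hi using Nat.le_induction with
  | base => rfl
  | succ n _ ih =>
    refine le_trans ?_ (ih (Nat.le_of_succ_le hn))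
    have hdepth : S.depth x n ≤ S.M := lastZero_le ..
    calc S.scale x (n + 1) + S.spacing (n + 1)
        = S.scale x n + (S.depth x n + 1) * S.spacing (n + 1) := by rw [scale_succ]; ring
      _ ≤ S.scale x n + (S.M + 1) * S.spacing (n + 1) := by gcongr
      _ = S.scale x n + S.spacing n := by rw [S.spacing_eq_mul hn]

lemma scale_add_spacing_le_blockLength (hn : n ≤ S.K) :
    S.scale x n + S.spacing n ≤ S.blockLength := by
  simpa [scale, blockLength] using S.scale_add_spacing_le (x := x) (Nat.zero_le n) hn

lemma scale_add_mul_spacing_lt {a : ℕ} (hn : n < S.K) (ha : a ≤ S.M) :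
    S.scale x n + a * S.spacing (n + 1) < S.blockLength := by
  refine lt_of_lt_of_le ?_ (S.scale_add_spacing_le_blockLength (x := x) hn.le)
  rw [S.spacing_eq_mul hn]
  gcongr
  · exact S.spacing_pos _
  · omega

lemma scale_congr {p : ℕ} (hn : n ≤ S.K) (hp : p ≤ S.offset n + S.blockLength)
    (h : x / 2 ^ p = y / 2 ^ p) : S.scale x n = S.scale y n := by
  induction n with
  | zero => rfl
  | succ n ih =>
    rw [← S.offset_eq_add hn] at hp
    rw [scale, scale, ih (Nat.le_of_succ_le hn) (by omega),
      lastZero_congr fun a _ => testBit_congr_of_div_eq h (by omega)]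

lemma depth_congr {p : ℕ} (hn : n ≤ S.K) (hp : p ≤ S.offset n) (h : x / 2 ^ p = y / 2 ^ p) :
    S.depth x n = S.depth y n := by
  rw [depth, depth, S.scale_congr hn (by omega) h]
  exact lastZero_congr fun a _ => testBit_congr_of_div_eq h (by omega)

lemma gain_congr {p : ℕ} (hn : n ≤ S.K) (hp : p ≤ S.offset n + S.blockLength)
    (h : x / 2 ^ p = y / 2 ^ p) : S.gain x n = S.gain y n := by
  refine sum_congr rfl fun i hi => ?_
  have hin : i < n := mem_range.1 hi
  have hoff : S.offset n ≤ S.offset (i + 1) := S.offset_antitone hin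
  rw [S.depth_congr (by omega) (by rw [S.offset_eq_add (by omega)]; omega) h]

section Mean

lemma expect_range_two_pow_length (hn : n ≤ S.K) (F : ℕ → ℝ) :
    𝔼 x ∈ range (2 ^ S.length), F x =
      𝔼 y ∈ range (2 ^ (S.blockLength * n)), 𝔼 D ∈ range (2 ^ (S.offset n + S.blockLength)),
        F (2 ^ (S.offset n + S.blockLength) * y + D) := by
  rw [← expect_range_two_pow_add, S.offset_add_blockLength_add hn]

lemma expect_exp_neg_gain_succ_le (hn : n < S.K) (y : ℕ) :
    𝔼 D ∈ range (2 ^ (S.offset n + S.blockLength)),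
        Real.exp (-S.gain (2 ^ (S.offset n + S.blockLength) * y + D) (n + 1)) ≤
      Real.exp (-S.gain (2 ^ (S.offset n + S.blockLength) * y) n) *
        Real.exp (-((1 / 2) ^ S.M * (1 + S.M / 2) / 2)) := by
  set m := S.offset n + S.blockLength
  have hM : S.scale (2 ^ m * y) n + S.M * S.spacing (n + 1) < S.blockLength :=
    S.scale_add_mul_spacing_lt hn le_rfl
  have hdiv : ∀ D ∈ range (2 ^ m), (2 ^ m * y + D) / 2 ^ m = 2 ^ m * y / 2 ^ m := fun D hD => by
    rw [two_pow_mul_add_div (mem_range.1 hD), Nat.mul_div_cancel_left _ (Nat.two_pow_pos m)]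
  have hgain : ∀ D ∈ range (2 ^ m), S.gain (2 ^ m * y + D) (n + 1) =
      S.gain (2 ^ m * y) n +
        (1 / 2) ^ lastZero S.M (S.offset n + S.scale (2 ^ m * y) n) (S.spacing (n + 1)) D := by
    intro D hD
    rw [gain_succ, S.gain_congr hn.le le_rfl (hdiv D hD), depth,
      S.scale_congr hn.le le_rfl (hdiv D hD), lastZero_congr fun a ha => ?_]
    have := Nat.mul_le_mul_right (S.spacing (n + 1)) ha
    exact testBit_two_pow_mul_add_of_lt (by omega) _ _
  rw [expect_congr rfl fun D hD => by rw [hgain D hD, neg_add, Real.exp_add], ← mul_expect]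
  gcongr
  exact expect_exp_neg_half_pow_lastZero_le (S.spacing_pos _) (by omega)

lemma expect_exp_neg_gain_le (hn : n ≤ S.K) :
    𝔼 x ∈ range (2 ^ S.length), Real.exp (-S.gain x n) ≤
      Real.exp (-(n * ((1 / 2) ^ S.M * (1 + S.M / 2) / 2))) := by
  set c : ℝ := (1 / 2) ^ S.M * (1 + S.M / 2) / 2
  induction n with
  | zero => simp [gain, expect_const]
  | succ n ih =>
    specialize ih (Nat.le_of_succ_le hn)
    rw [S.expect_range_two_pow_length (Nat.le_of_succ_le hn)] at ih ⊢
    set m := S.offset n + S.blockLength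
    calc 𝔼 y ∈ range (2 ^ (S.blockLength * n)), 𝔼 D ∈ range (2 ^ m),
          Real.exp (-S.gain (2 ^ m * y + D) (n + 1))
        ≤ 𝔼 y ∈ range (2 ^ (S.blockLength * n)),
          Real.exp (-S.gain (2 ^ m * y) n) * Real.exp (-c) :=
          expect_le_expect fun y _ => S.expect_exp_neg_gain_succ_le hn y
      _ = (𝔼 y ∈ range (2 ^ (S.blockLength * n)), 𝔼 D ∈ range (2 ^ m),
          Real.exp (-S.gain (2 ^ m * y + D) n)) * Real.exp (-c) := by
          rw [expect_mul]
          refine expect_congr rfl fun y _ => ?_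
          rw [expect_congr rfl fun D hD => ?_, expect_const (by simp)]
          rw [S.gain_congr (Nat.le_of_succ_le hn) le_rfl]
          rw [two_pow_mul_add_div (mem_range.1 hD),
            Nat.mul_div_cancel_left _ (Nat.two_pow_pos m)]
      _ ≤ Real.exp (-(n * c)) * Real.exp (-c) := by gcongr
      _ = Real.exp (-((n + 1 : ℕ) * c)) := by
          rw [← Real.exp_add]
          congr 1
          push_cast
          ring

lemma card_filter_gain_lt_le (hK : S.K = 2 ^ (S.M + 2)) :
    2 * #{x ∈ range (2 ^ S.length) | S.gain x S.K < 1 + S.M / 2} ≤ 2 ^ S.length := by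
  set g : ℝ := 1 + S.M / 2 with hg
  have hexponent : S.K * ((1 / 2) ^ S.M * g / 2) = 2 * g := by
    rw [hK]
    push_cast
    rw [pow_add, one_div, inv_pow]
    field_simp
  have hmarkov : ∀ x, (if S.gain x S.K < g then (1 : ℝ) else 0) ≤
      Real.exp g * Real.exp (-S.gain x S.K) := by
    intro x
    rw [← Real.exp_add]
    split_ifs with h
    · exact Real.one_le_exp (by linarith)
    · positivity
  have hexp : 2 ≤ Real.exp g := by
    have : (0 : ℝ) ≤ S.M := Nat.cast_nonneg _
    linarith [Real.add_one_le_exp g]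
  have hmean : 𝔼 x ∈ range (2 ^ S.length), (if S.gain x S.K < g then (1 : ℝ) else 0) ≤ 1 / 2 :=
    calc _ ≤ 𝔼 x ∈ range (2 ^ S.length), Real.exp g * Real.exp (-S.gain x S.K) :=
          expect_le_expect fun x _ => hmarkov x
      _ ≤ Real.exp g * Real.exp (-(2 * g)) := by
          rw [← mul_expect, ← hexponent]
          gcongr
          exact S.expect_exp_neg_gain_le le_rfl
      _ = 1 / Real.exp g := by
          rw [← Real.exp_add, one_div, ← Real.exp_neg]
          ring_nf
      _ ≤ 1 / 2 := one_div_le_one_div_of_le two_pos hexp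
  rw [expect_eq_sum_div_card, sum_boole, card_range, div_le_iff₀ (by positivity)] at hmean
  rw [← Nat.cast_le (α := ℝ)]
  push_cast at hmean ⊢
  linarith

/-- The points at which the maximal function is bounded below: the gain is large, and passing to
the next interval of length `2 ^ p` never affects the bits at the places from `p + v` on. -/
noncomputable def goodPoints : Finset ℕ :=
  {x ∈ range (2 ^ S.length) | 1 + S.M / 2 ≤ S.gain x S.K ∧
    ∀ p ≤ S.length, p + S.v ≤ S.length → ∃ j < S.v, x.testBit (p + j) = false}

lemma two_pow_length_le_card_goodPoints (hK : S.K = 2 ^ (S.M + 2))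
    (hv : 4 * (S.length + 1) ≤ 2 ^ S.v) : 2 ^ S.length ≤ 4 * #S.goodPoints := by
  have hgain := S.card_filter_gain_lt_le hK
  have hcarry := card_filter_exists_window_le hv
  set A := {x ∈ range (2 ^ S.length) | S.gain x S.K < 1 + S.M / 2}
  set C := {x ∈ range (2 ^ S.length) |
    ∃ p ≤ S.length, p + S.v ≤ S.length ∧ ∀ j < S.v, x.testBit (p + j)}
  have hcover : range (2 ^ S.length) ⊆ S.goodPoints ∪ (A ∪ C) := by
    intro x hx
    by_contra! h
    simp only [goodPoints, A, C, mem_union, mem_filter, hx, true_and, not_or, not_lt, not_and,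
      not_exists, not_forall, Bool.not_eq_true] at h
    obtain ⟨hgood, hxA, hxC⟩ := h
    obtain ⟨p, hp, hpv, hone⟩ := hgood hxA
    obtain ⟨j, hj, hzero⟩ := hxC p hp hpv
    exact hone j hj hzero
  have hcard := (card_le_card hcover).trans
    ((card_union_le _ _).trans (Nat.add_le_add_left (card_union_le _ _) _))
  rw [card_range] at hcard
  omega

end Mean

section Spikes

lemma isSpike_two_pow_mul_add (hn : n < S.K) {y D : ℕ}
    (hD : D < 2 ^ (S.offset n + S.blockLength)) :
    S.IsSpike n (2 ^ (S.offset n + S.blockLength) * y + D) ↔ D % 2 ^ S.offset n = n ∧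
      ∀ p ∈ (Icc 1 S.M).image fun a =>
        S.offset n + S.scale (2 ^ (S.offset n + S.blockLength) * y) n + a * S.spacing (n + 1),
        D.testBit p := by
  set m := S.offset n + S.blockLength with hm
  have hscale : S.scale (2 ^ m * y + D) n = S.scale (2 ^ m * y) n :=
    S.scale_congr hn.le le_rfl <| by
      rw [two_pow_mul_add_div hD, Nat.mul_div_cancel_left _ (Nat.two_pow_pos m)]
  have hlabel : (2 ^ m * y + D) % 2 ^ S.offset n = D % 2 ^ S.offset n := by
    rw [hm, pow_add, mul_assoc, Nat.mul_add_mod]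
  rw [IsSpike, hlabel, hscale, forall_mem_image]
  refine and_congr_right fun _ => forall₂_congr fun a ha => ?_
  have := S.scale_add_mul_spacing_lt (x := 2 ^ m * y) hn (mem_Icc.1 ha).2
  rw [testBit_two_pow_mul_add_of_lt (by omega)]

lemma expect_isSpike (hn : n < S.K) (hlabel : n < 2 ^ S.offset n) :
    𝔼 x ∈ range (2 ^ S.length), (if S.IsSpike n x then (1 : ℝ) else 0) =
      (1 / 2) ^ (S.offset n + S.M) := by
  rw [S.expect_range_two_pow_length hn.le]
  refine (expect_congr rfl fun y _ => ?_).trans (expect_const (by simp) _)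
  rw [expect_congr rfl fun D hD =>
    if_congr (S.isSpike_two_pow_mul_add hn (mem_range.1 hD)) rfl rfl,
    expect_mod_eq_and_testBit (Nat.le_add_right _ _) hlabel, card_image_add_mul (S.spacing_pos _),
    Nat.card_Icc, Nat.add_sub_cancel]
  refine image_subset_iff.2 fun a ha => mem_Ico.2 ?_
  have := S.scale_add_mul_spacing_lt (x := 2 ^ (S.offset n + S.blockLength) * y) hn (mem_Icc.1 ha).2
  omega

lemma expect_spikeSum (hlabel : ∀ n < S.K, n < 2 ^ S.offset n) :
    𝔼 x ∈ range (2 ^ S.length), S.spikeSum x = S.K * (1 / 2) ^ S.M := by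
  simp only [spikeSum]
  rw [expect_sum_comm, ← nsmul_eq_mul, ← card_range S.K, ← sum_const, card_range]
  refine sum_congr rfl fun n hn => ?_
  have hn' := mem_range.1 hn
  calc 𝔼 x ∈ range (2 ^ S.length), (if S.IsSpike n x then (2 : ℝ) ^ S.offset n else 0)
      = 2 ^ S.offset n * 𝔼 x ∈ range (2 ^ S.length), if S.IsSpike n x then (1 : ℝ) else 0 := by
        simp only [mul_expect, mul_ite, mul_one, mul_zero]
    _ = (1 / 2) ^ S.M := by
        rw [S.expect_isSpike hn' (hlabel n hn'), pow_add, ← mul_assoc, ← mul_pow]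
        norm_num

lemma spikeSum_nonneg (y : ℕ) : 0 ≤ S.spikeSum y :=
  sum_nonneg fun _ _ => by positivity

lemma le_spikeSum (hn : n < S.K) (hy : S.IsSpike n y) : 2 ^ S.offset n ≤ S.spikeSum y := by
  have := single_le_sum (f := fun n => if S.IsSpike n y then (2 : ℝ) ^ S.offset n else 0)
    (fun _ _ => by positivity) (mem_range.2 hn)
  rwa [if_pos hy] at this

variable {S} in
lemma IsSpike.unique {i : ℕ} (hlabel : n < 2 ^ S.offset i) (hni : n ≤ i) (hn : S.IsSpike n y)
    (hi : S.IsSpike i y) : n = i := by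
  rw [← hi.1, ← Nat.mod_mod_of_dvd y (pow_dvd_pow 2 (S.offset_antitone hni)), hn.1,
    Nat.mod_eq_of_lt hlabel]

/-- The spikes of level `n` are counted in the dyadic interval of length `2 ^ cutoff` that follows
the one containing `x`. -/
def cutoff (x n : ℕ) : ℕ := S.offset n + S.scale x S.K + 1

lemma cutoff_add_le (hn : n ≤ S.K) :
    S.cutoff x n + S.v ≤ S.offset n + S.scale x n + S.spacing n := by
  have := S.scale_add_spacing_le (x := x) hn le_rfl
  rw [spacing_K] at this
  rw [cutoff]
  omega

lemma cutoff_add_le_offset_add (hn : n ≤ S.K) :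
    S.cutoff x n + S.v ≤ S.offset n + S.blockLength := by
  have := S.cutoff_add_le (x := x) hn
  have := S.scale_add_spacing_le_blockLength (x := x) hn
  omega

lemma add_mul_spacing_lt_cutoff {a : ℕ} (hn : n < S.K) (ha : a ≤ S.depth x n) :
    S.offset n + S.scale x n + a * S.spacing (n + 1) < S.cutoff x n := by
  have hscale := S.scale_mono x (Nat.succ_le_of_lt hn)
  have hmul := Nat.mul_le_mul_right (S.spacing (n + 1)) ha
  rw [Nat.succ_eq_add_one, scale_succ] at hscale
  rw [cutoff]
  omega

lemma cutoff_add_le_add_mul_spacing {a : ℕ} (hn : n < S.K) (ha : S.depth x n < a) :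
    S.cutoff x n + S.v ≤ S.offset n + S.scale x n + a * S.spacing (n + 1) := by
  have hscale := S.scale_add_spacing_le (x := x) (Nat.succ_le_of_lt hn) le_rfl
  have hmul := Nat.mul_le_mul_right (S.spacing (n + 1)) (Nat.succ_le_of_lt ha)
  rw [Nat.succ_eq_add_one, scale_succ, spacing_K] at hscale
  rw [Nat.succ_mul] at hmul
  rw [cutoff]
  omega

/-- Of the bits that decide about the depth, those beyond the final scale of `x` are shared by `x`
and equal to `1`, and those before it are free. -/
lemma isSpike_next_interval_iff (hn : n < S.K) {E : ℕ}
    (hcarry : ∃ j < S.v, x.testBit (S.cutoff x n + j) = false)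
    (hE : E < 2 ^ S.cutoff x n) :
    S.IsSpike n (2 ^ S.cutoff x n * (x / 2 ^ S.cutoff x n + 1) + E) ↔ E % 2 ^ S.offset n = n ∧
      ∀ p ∈ (Icc 1 (S.depth x n)).image fun a =>
        S.offset n + S.scale x n + a * S.spacing (n + 1), E.testBit p := by
  set m := S.cutoff x n with hm
  set y := 2 ^ m * (x / 2 ^ m + 1) + E with hy
  have hdiv : y / 2 ^ (m + S.v) = x / 2 ^ (m + S.v) := next_interval_div_two_pow hE hcarry
  have hscale : S.scale y n = S.scale x n :=
    S.scale_congr hn.le (S.cutoff_add_le_offset_add hn.le) hdiv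
  have hlabel : y % 2 ^ S.offset n = E % 2 ^ S.offset n := by
    rw [hy, hm, cutoff, add_assoc, pow_add, mul_assoc, Nat.mul_add_mod]
  have hdepth : S.depth x n ≤ S.M := lastZero_le ..
  rw [IsSpike, hlabel, hscale, forall_mem_image]
  refine and_congr_right fun _ => ⟨fun h a ha => ?_, fun h a ha => ?_⟩
  · obtain ⟨ha1, had⟩ := mem_Icc.1 ha
    rw [← testBit_two_pow_mul_add_of_lt (S.add_mul_spacing_lt_cutoff hn had)]
    exact h a (mem_Icc.2 ⟨ha1, had.trans hdepth⟩)
  · obtain ⟨ha1, haM⟩ := mem_Icc.1 ha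
    obtain had | had := le_or_gt a (S.depth x n)
    · rw [testBit_two_pow_mul_add_of_lt (S.add_mul_spacing_lt_cutoff hn had)]
      exact h (mem_Icc.2 ⟨ha1, had⟩)
    · rw [testBit_congr_of_div_eq hdiv (S.cutoff_add_le_add_mul_spacing hn had)]
      exact testBit_of_lastZero_lt had haM

/-- The times `k` after which a spike of level `n` is met from `x`, at the distances that count for
the final scale of `x`. -/
def spikeTimes (x n : ℕ) : Finset ℕ :=
  {k ∈ Ico 1 (2 ^ (S.cutoff x n + 1)) | x + k < 2 ^ S.length ∧ S.IsSpike n (x + k)}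

lemma card_filter_isSpike (hn : n < S.K) (hlabel : n < 2 ^ S.offset n)
    (hcarry : ∃ j < S.v, x.testBit (S.cutoff x n + j) = false) :
    (#{E ∈ range (2 ^ S.cutoff x n) |
        S.IsSpike n (2 ^ S.cutoff x n * (x / 2 ^ S.cutoff x n + 1) + E)} : ℝ) =
      2 ^ (S.scale x S.K + 1) * (1 / 2) ^ S.depth x n := by
  have hplaces : (Icc 1 (S.depth x n)).image
      (fun a => S.offset n + S.scale x n + a * S.spacing (n + 1)) ⊆
        Ico (S.offset n) (S.cutoff x n) :=
    image_subset_iff.2 fun a ha => mem_Ico.2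
      ⟨by omega, S.add_mul_spacing_lt_cutoff hn (mem_Icc.1 ha).2⟩
  have hoffset : S.offset n ≤ S.cutoff x n := by rw [cutoff]; omega
  have hmean := expect_mod_eq_and_testBit hoffset hlabel hplaces
  rw [card_image_add_mul (S.spacing_pos _), Nat.card_Icc, Nat.add_sub_cancel,
    expect_congr rfl fun E hE =>
      if_congr (S.isSpike_next_interval_iff hn hcarry (mem_range.1 hE)).symm rfl rfl,
    expect_eq_sum_div_card, sum_boole, card_range, div_eq_iff (by positivity)] at hmean
  rw [hmean, cutoff, add_assoc]
  push_cast
  rw [pow_add, pow_add 2 (S.offset n), one_div, inv_pow, inv_pow]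
  field_simp

lemma le_card_spikeTimes (hx : x < 2 ^ S.length) (hn : n < S.K) (hlabel : n < 2 ^ S.offset n)
    (hcarry : ∃ j < S.v, x.testBit (S.cutoff x n + j) = false) :
    2 ^ (S.scale x S.K + 1) * (1 / 2) ^ S.depth x n ≤ (#(S.spikeTimes x n) : ℝ) := by
  rw [← S.card_filter_isSpike hn hlabel hcarry, Nat.cast_le]
  set m := S.cutoff x n with hm
  have hdiv := Nat.div_add_mod x (2 ^ m)
  have hgt : ∀ E, x < 2 ^ m * (x / 2 ^ m + 1) + E := fun E =>
    (Nat.lt_mul_div_succ x (Nat.two_pow_pos m)).trans_le (Nat.le_add_right _ _)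
  refine card_le_card_of_injOn (fun E => 2 ^ m * (x / 2 ^ m + 1) + E - x) (fun E hE => ?_) ?_
  · obtain ⟨hE, hspike⟩ := mem_filter.1 (mem_coe.1 hE)
    have hEm := mem_range.1 hE
    have hadd := Nat.add_sub_of_le (hgt E).le
    refine mem_coe.2 (mem_filter.2 ⟨mem_Ico.2 ⟨?_, ?_⟩, ?_, ?_⟩)
    · have := hgt E
      dsimp only
      omega
    · dsimp only
      rw [← hm, mul_add_one, pow_succ]
      omega
    · rw [hadd]
      exact lt_two_pow_of_div_eq (next_interval_div_two_pow hEm hcarry)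
        ((S.cutoff_add_le_offset_add hn.le).trans (S.offset_add_blockLength_le hn.le)) hx
    · rwa [hadd]
  · intro E _ E' _ h
    have := hgt E
    have := hgt E'
    dsimp only at h
    omega

lemma lt_two_pow_offset (hv : 4 * (S.length + 1) ≤ 2 ^ S.v) (hn : n < S.K) :
    n < 2 ^ S.offset n := by
  have hblock : S.v + 1 ≤ S.blockLength := Nat.le_mul_of_pos_right _ (by positivity)
  have hlength : S.K + 1 ≤ S.length := Nat.le_mul_of_pos_left _ (by omega)
  have hoffset : S.blockLength ≤ S.offset n := Nat.le_mul_of_pos_right _ (by omega)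
  have hpow : 2 ^ S.v ≤ 2 ^ S.offset n := Nat.pow_le_pow_right two_pos (by omega)
  omega

lemma lt_spikeSum_div {k : ℕ} (hn : n < S.K) (hk : k ∈ S.spikeTimes x n) :
    1 / 2 ^ (S.scale x S.K + 2) < S.spikeSum (x + k) / k := by
  obtain ⟨hk, -, hspike⟩ := mem_filter.1 hk
  obtain ⟨hk1, hklt⟩ := mem_Ico.1 hk
  have hkpos : (0 : ℝ) < k := by exact_mod_cast hk1
  have hklt' : (k : ℝ) < 2 ^ (S.cutoff x n + 1) := by exact_mod_cast hklt
  rw [lt_div_iff₀ hkpos, one_div_mul_eq_div, div_lt_iff₀ (by positivity)]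
  calc (k : ℝ) < 2 ^ (S.cutoff x n + 1) := hklt'
    _ = 2 ^ S.offset n * 2 ^ (S.scale x S.K + 2) := by rw [cutoff, ← pow_add]; congr 1
    _ ≤ S.spikeSum (x + k) * 2 ^ (S.scale x S.K + 2) := by gcongr; exact S.le_spikeSum hn hspike

lemma pairwiseDisjoint_spikeTimes (hlabel : ∀ n < S.K, n < 2 ^ S.offset n) (x : ℕ) :
    (range S.K : Set ℕ).PairwiseDisjoint (S.spikeTimes x) := by
  intro n hn i hi hni
  have hnK : n < S.K := mem_range.1 hn
  have hiK : i < S.K := mem_range.1 hi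
  refine disjoint_left.2 fun k hkn hki => hni ?_
  have hspiken : S.IsSpike n (x + k) := (mem_filter.1 hkn).2.2
  have hspikei : S.IsSpike i (x + k) := (mem_filter.1 hki).2.2
  obtain h | h := le_total n i
  · exact hspiken.unique (h.trans_lt (hlabel i hiK)) h hspikei
  · exact (hspikei.unique (h.trans_lt (hlabel n hnK)) h hspiken).symm

lemma le_card_biUnion_spikeTimes (hv : 4 * (S.length + 1) ≤ 2 ^ S.v) (hx : x ∈ S.goodPoints) :
    2 ^ (S.scale x S.K + 1) * (1 + S.M / 2) ≤
      (#((range S.K).biUnion (S.spikeTimes x)) : ℝ) := by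
  obtain ⟨hx, hgain, hcarry⟩ := mem_filter.1 hx
  rw [card_biUnion (S.pairwiseDisjoint_spikeTimes (fun n => S.lt_two_pow_offset hv) x)]
  calc (2 : ℝ) ^ (S.scale x S.K + 1) * (1 + S.M / 2)
      ≤ 2 ^ (S.scale x S.K + 1) * S.gain x S.K := by gcongr
    _ = ∑ n ∈ range S.K, 2 ^ (S.scale x S.K + 1) * (1 / 2) ^ S.depth x n := mul_sum ..
    _ ≤ ∑ n ∈ range S.K, (#(S.spikeTimes x n) : ℝ) := sum_le_sum fun n hn => ?_
    _ = _ := (Nat.cast_sum ..).symm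
  have hnK := mem_range.1 hn
  have hcutoff := (S.cutoff_add_le_offset_add (x := x) hnK.le).trans
    (S.offset_add_blockLength_le hnK.le)
  exact S.le_card_spikeTimes (mem_range.1 hx) hnK (S.lt_two_pow_offset hv hnK)
    (hcarry _ (by omega) hcutoff)

end Spikes

end Scheme

section Circle

/-- The index of the interval `[y / N, (y + 1) / N)` that contains `x`. -/
noncomputable def cell (N : ℕ) (x : UnitAddCircle) : ℕ :=
  ⌊(N : ℝ) * (AddCircle.equivIco 1 0 x : ℝ)⌋₊

variable {N J : ℕ}

lemma measurable_cell (N : ℕ) : Measurable (cell N) :=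
  Nat.measurable_floor.comp (measurable_const.mul
    (measurable_subtype_coe.comp (AddCircle.measurableEquivIco 1 0).measurable))

lemma cell_coe (N : ℕ) {t : ℝ} (ht : t ∈ Set.Ico (0 : ℝ) 1) :
    cell N (t : UnitAddCircle) = ⌊(N : ℝ) * t⌋₊ := by
  rw [cell, AddCircle.equivIco_coe_of_mem (by simpa using ht)]

lemma exists_mem_Ico_coe_eq (x : UnitAddCircle) :
    ∃ t ∈ Set.Ico (0 : ℝ) 1, (t : UnitAddCircle) = x :=
  ⟨AddCircle.equivIco 1 0 x, by simpa using (AddCircle.equivIco 1 0 x).2, AddCircle.coe_equivIco⟩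

lemma cell_lt (hN : 0 < N) (x : UnitAddCircle) : cell N x < N := by
  obtain ⟨t, ht, rfl⟩ := exists_mem_Ico_coe_eq x
  have hN' : (0 : ℝ) < N := by exact_mod_cast hN
  rw [cell_coe N ht, Nat.floor_lt (mul_nonneg hN'.le ht.1)]
  exact mul_lt_of_lt_one_right hN' ht.2

lemma coe_preimage_cell_inter {y : ℕ} (hy : y < N) :
    ((↑) : ℝ → UnitAddCircle) ⁻¹' (cell N ⁻¹' {y}) ∩ Set.Ico 0 1 =
      Set.Ico ((y : ℝ) / N) ((y + 1) / N) := by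
  have hN : (0 : ℝ) < N := by exact_mod_cast (Nat.zero_le y).trans_lt hy
  have hle : ((y : ℝ) + 1) / N ≤ 1 := (div_le_one hN).2 (by exact_mod_cast hy)
  have hiff : ∀ t ∈ Set.Ico (0 : ℝ) 1,
      cell N (t : UnitAddCircle) = y ↔ t ∈ Set.Ico ((y : ℝ) / N) ((y + 1) / N) := by
    intro t ht
    rw [cell_coe N ht, Nat.floor_eq_iff (mul_nonneg hN.le ht.1), Set.mem_Ico, div_le_iff₀ hN,
      lt_div_iff₀ hN, mul_comm t]
  ext t
  refine ⟨fun ⟨hcell, ht⟩ => (hiff t ht).1 hcell, fun ht => ?_⟩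
  have ht' : t ∈ Set.Ico (0 : ℝ) 1 := ⟨le_trans (by positivity) ht.1, ht.2.trans_le hle⟩
  exact ⟨(hiff t ht').2 ht, ht'⟩

lemma volume_preimage_cell {y : ℕ} (hy : y < N) : volume (cell N ⁻¹' {y}) = (N : ℝ≥0∞)⁻¹ := by
  have hN : (0 : ℝ) < N := by exact_mod_cast (Nat.zero_le y).trans_lt hy
  have hmeas := measurable_cell N (measurableSet_singleton y)
  have hmk := UnitAddCircle.measurePreserving_mk 0
  rw [← hmk.measure_preimage hmeas.nullMeasurableSet, zero_add,
    Measure.restrict_congr_set Ico_ae_eq_Ioc.symm, Measure.restrict_apply (hmk.measurable hmeas),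
    coe_preimage_cell_inter hy, Real.volume_Ico, ← sub_div, add_sub_cancel_left, one_div,
    ENNReal.ofReal_inv_of_pos hN, ENNReal.ofReal_natCast]

lemma map_cell_volume (hN : 0 < N) :
    (volume : Measure UnitAddCircle).map (cell N) =
      (N : ℝ≥0∞)⁻¹ • ∑ y ∈ range N, Measure.dirac y := by
  refine Measure.ext_of_singleton fun y => ?_
  rw [Measure.map_apply (measurable_cell N) (measurableSet_singleton y)]
  by_cases hy : y < N
  · rw [volume_preimage_cell hy]
    simp [hy, Set.indicator_apply, eq_comm]
  · have hempty : cell N ⁻¹' {y} = ∅ :=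
      Set.eq_empty_of_forall_notMem fun x hx => hy (hx ▸ cell_lt hN x)
    simp [hempty, hy, Set.indicator_apply]

lemma volume_cell_mem (hN : 0 < N) {G : Finset ℕ} (hG : G ⊆ range N) :
    volume {x | cell N x ∈ G} = (#G : ℝ≥0∞) / N := by
  have hG' : MeasurableSet (G : Set ℕ) := G.measurableSet
  change volume (cell N ⁻¹' G) = _
  rw [← Measure.map_apply (measurable_cell N) hG', map_cell_volume hN, Measure.smul_apply,
    Measure.finsetSum_apply]
  simp [Set.indicator_apply, inter_eq_right.2 hG, ENNReal.div_eq_inv_mul]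

lemma eLpNorm_comp_cell (hN : 0 < N) {g : ℕ → ℝ} (hg : ∀ y, 0 ≤ g y) :
    eLpNorm (g ∘ cell N) 1 volume = ENNReal.ofReal (𝔼 y ∈ range N, g y) := by
  have hN' : (0 : ℝ) < N := by exact_mod_cast hN
  rw [eLpNorm_one_eq_lintegral_enorm]
  simp only [Function.comp_apply, Real.enorm_of_nonneg (hg _)]
  rw [← lintegral_map (f := fun y => ENNReal.ofReal (g y)) (measurable_of_countable _)
    (measurable_cell N), map_cell_volume hN, lintegral_smul_measure,
    lintegral_finsetSum_measure]
  simp only [lintegral_dirac]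
  rw [expect_eq_sum_div_card, card_range, ENNReal.ofReal_div_of_pos hN', ENNReal.ofReal_natCast,
    ENNReal.ofReal_sum_of_nonneg fun y _ => hg y, smul_eq_mul, ENNReal.div_eq_inv_mul]

lemma cell_dyadicRotation {x : UnitAddCircle} (h : cell (2 ^ J) x + 1 < 2 ^ J) :
    cell (2 ^ J) (dyadicRotation J x) = cell (2 ^ J) x + 1 := by
  obtain ⟨t, ht, rfl⟩ := exists_mem_Ico_coe_eq x
  have hJ : (0 : ℝ) < 2 ^ J := by positivity
  have hadd : (2 : ℝ) ^ J * (t + (2 ^ J)⁻¹) = 2 ^ J * t + 1 := by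
    rw [mul_add, mul_inv_cancel₀ hJ.ne']
  rw [cell_coe _ ht] at h ⊢
  push_cast at h ⊢
  have hlt : t + ((2 : ℝ) ^ J)⁻¹ < 1 := by
    refine lt_of_mul_lt_mul_left ?_ hJ.le
    have hfloor := Nat.lt_floor_add_one ((2 : ℝ) ^ J * t)
    have h' : (⌊(2 : ℝ) ^ J * t⌋₊ : ℝ) + 1 + 1 ≤ 2 ^ J := by exact_mod_cast h
    linarith
  rw [dyadicRotation, ← AddCircle.coe_add, cell_coe _ ⟨add_nonneg ht.1 (by positivity), hlt⟩]
  push_cast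
  rw [hadd, Nat.floor_add_one (mul_nonneg hJ.le ht.1)]

lemma cell_iterate_dyadicRotation {k : ℕ} {x : UnitAddCircle} (h : cell (2 ^ J) x + k < 2 ^ J) :
    cell (2 ^ J) ((dyadicRotation J)^[k] x) = cell (2 ^ J) x + k := by
  induction k with
  | zero => rfl
  | succ k ih =>
    have hk := ih (by omega)
    rw [Function.iterate_succ_apply', cell_dyadicRotation (by omega), hk, add_assoc]

end Circle

section WeakType

lemma le_weakTypeConst {X : Type*} [MeasurableSpace X] {μ : Measure X} {T : X → X} {f : X → ℝ}
    (hf : Integrable f μ) (h0 : 0 ≤ᵐ[μ] f) (h1 : eLpNorm f 1 μ = 1) {lam : ℝ≥0} (hlam : 0 < lam) :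
    (lam : ℝ≥0∞) * μ {x | maximalCount T f x > (lam : ℝ≥0∞)} ≤ weakTypeConst μ T :=
  le_iSup_of_le f <| le_iSup_of_le hf <| le_iSup_of_le h0 <| le_iSup_of_le h1 <|
    le_iSup_of_le lam <| le_iSup_of_le hlam le_rfl

lemma lt_maximalCount {X : Type*} {T : X → X} {f : X → ℝ} {x : X} {lam : ℝ≥0} {n : ℕ} (hn : 1 ≤ n)
    {B : Finset ℕ} (hB : ∀ k ∈ B, 1 ≤ k ∧ f (T^[k] x) / (k : ℝ) > 1 / (n : ℝ))
    (hlt : lam * n < #B) : (lam : ℝ≥0∞) < maximalCount T f x := by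
  have hcount : ((#B : ℕ) : ℝ≥0∞) ≤ (count T f n x : ℝ≥0∞) := by
    rw [← ENat.toENNReal_coe, ENat.toENNReal_le, ← Set.encard_coe_eq_coe_finsetCard]
    exact Set.encard_le_encard hB
  have hn0 : (n : ℝ≥0∞) ≠ 0 := by exact_mod_cast (Nat.one_le_iff_ne_zero.1 hn)
  calc (lam : ℝ≥0∞) < #B / n := by
        rw [ENNReal.lt_div_iff_mul_lt (Or.inl hn0) (Or.inl (ENNReal.natCast_ne_top n))]
        exact_mod_cast hlt
    _ ≤ count T f n x / n := ENNReal.div_le_div_right hcount _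
    _ ≤ maximalCount T f x := le_iSup₂_of_le n hn le_rfl

lemma le_weakTypeConst_dyadicRotation {J : ℕ} {g : ℕ → ℝ} (hg : ∀ y, 0 ≤ g y)
    (hmean : 𝔼 y ∈ range (2 ^ J), g y = 1) {lam : ℝ≥0} (hlam : 0 < lam) {G : Finset ℕ}
    (hG : G ⊆ range (2 ^ J))
    (hlarge : ∀ x ∈ G, ∃ n : ℕ, 1 ≤ n ∧ ∃ B : Finset ℕ, lam * n < #B ∧
      ∀ k ∈ B, 1 ≤ k ∧ x + k < 2 ^ J ∧ 1 / (n : ℝ) < g (x + k) / k) :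
    (lam : ℝ≥0∞) * (#G / 2 ^ J) ≤ weakTypeConst volume (dyadicRotation J) := by
  have hJ : 0 < 2 ^ J := Nat.two_pow_pos J
  have hnorm : eLpNorm (g ∘ cell (2 ^ J)) 1 volume = 1 := by
    rw [eLpNorm_comp_cell hJ hg, hmean, ENNReal.ofReal_one]
  have hint : Integrable (g ∘ cell (2 ^ J)) volume := memLp_one_iff_integrable.1
    ⟨((measurable_of_countable g).comp (measurable_cell _)).aestronglyMeasurable,
      hnorm.trans_lt ENNReal.one_lt_top⟩
  have hsub : {x | cell (2 ^ J) x ∈ G} ⊆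
      {x | maximalCount (dyadicRotation J) (g ∘ cell (2 ^ J)) x > (lam : ℝ≥0∞)} := by
    intro x hx
    obtain ⟨n, hn, B, hcard, hB⟩ := hlarge _ hx
    refine lt_maximalCount hn (fun k hk => ?_) hcard
    obtain ⟨hk1, hlt, hval⟩ := hB k hk
    exact ⟨hk1, by rwa [Function.comp_apply, cell_iterate_dyadicRotation hlt]⟩
  calc (lam : ℝ≥0∞) * (#G / 2 ^ J) = lam * volume {x | cell (2 ^ J) x ∈ G} := by
        rw [volume_cell_mem hJ hG, Nat.cast_pow, Nat.cast_ofNat]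
    _ ≤ lam * volume {x | maximalCount (dyadicRotation J) (g ∘ cell (2 ^ J)) x > (lam : ℝ≥0∞)} := by
        gcongr
    _ ≤ _ := le_weakTypeConst hint (ae_of_all _ fun x => hg _) hnorm hlam

lemma exists_mul_succ_le_two_pow (C : ℕ) : ∃ v : ℕ, C * (v + 1) ≤ 2 ^ v := by
  refine ⟨C * 3, ?_⟩
  calc C * (C * 3 + 1) ≤ (C + 1) ^ 3 := by ring_nf; omega
    _ ≤ (2 ^ C) ^ 3 := Nat.pow_le_pow_left Nat.lt_two_pow_self 3
    _ = 2 ^ (C * 3) := (pow_mul ..).symm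

lemma Scheme.exists_four_mul_length_succ_le (M K : ℕ) :
    ∃ S : Scheme, S.M = M ∧ S.K = K ∧ 4 * (S.length + 1) ≤ 2 ^ S.v := by
  obtain ⟨v, hv⟩ := exists_mul_succ_le_two_pow (4 * ((M + 1) ^ K * (K + 1) + 1))
  refine ⟨⟨M, K, v⟩, rfl, rfl, le_trans ?_ hv⟩
  simp only [length, blockLength, spacing, Nat.sub_zero]
  nlinarith [Nat.zero_le v]

lemma Scheme.exists_lt_card_of_mem_goodPoints (S : Scheme) {x : ℕ}
    (hv : 4 * (S.length + 1) ≤ 2 ^ S.v) (hx : x ∈ S.goodPoints) :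
    ∃ n : ℕ, 1 ≤ n ∧ ∃ B : Finset ℕ, ((S.M + 1) / 16 : ℝ≥0) * n < #B ∧
      ∀ k ∈ B, 1 ≤ k ∧ x + k < 2 ^ S.length ∧ 1 / (n : ℝ) < S.spikeSum (x + k) / 4 / k := by
  refine ⟨2 ^ (S.scale x S.K + 4), Nat.one_le_two_pow,
    (range S.K).biUnion (S.spikeTimes x), ?_, fun k hk => ?_⟩
  · rw [← NNReal.coe_lt_coe]
    push_cast
    refine lt_of_lt_of_le ?_ (S.le_card_biUnion_spikeTimes hv hx)
    have hpos : (0 : ℝ) < 2 ^ S.scale x S.K := by positivity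
    rw [pow_add, pow_add]
    linarith
  · obtain ⟨n, hn, hk⟩ := mem_biUnion.1 hk
    have hval := S.lt_spikeSum_div (mem_range.1 hn) hk
    obtain ⟨hk, hlt, -⟩ := mem_filter.1 hk
    refine ⟨(mem_Ico.1 hk).1, hlt, ?_⟩
    push_cast
    calc 1 / (2 : ℝ) ^ (S.scale x S.K + 4) = 1 / 2 ^ (S.scale x S.K + 2) / 4 := by
          rw [div_div, pow_add, pow_add, mul_assoc]
          norm_num
      _ < S.spikeSum (x + k) / k / 4 := by gcongr
      _ = _ := div_right_comm ..

lemma Scheme.le_weakTypeConst (S : Scheme) (hK : S.K = 2 ^ (S.M + 2))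
    (hv : 4 * (S.length + 1) ≤ 2 ^ S.v) :
    (((S.M + 1) / 64 : ℝ≥0) : ℝ≥0∞) ≤ weakTypeConst volume (dyadicRotation S.length) := by
  have hmean : 𝔼 y ∈ range (2 ^ S.length), S.spikeSum y / 4 = 1 := by
    rw [← expect_div, S.expect_spikeSum fun n => S.lt_two_pow_offset hv, hK]
    push_cast
    rw [pow_add, one_div, inv_pow]
    field_simp
    norm_num
  have hgood : (4 : ℝ≥0∞)⁻¹ ≤ #S.goodPoints / 2 ^ S.length := by
    rw [ENNReal.le_div_iff_mul_le (Or.inl (by simp)) (Or.inl (by simp)),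
      ENNReal.inv_mul_le_iff (by simp) (by simp)]
    exact_mod_cast S.two_pow_length_le_card_goodPoints hK hv
  calc (((S.M + 1) / 64 : ℝ≥0) : ℝ≥0∞) = ((S.M + 1) / 16 : ℝ≥0) * (4 : ℝ≥0∞)⁻¹ := by
        rw [show ((S.M + 1) / 64 : ℝ≥0) = (S.M + 1) / 16 * 4⁻¹ by field_simp; norm_num,
          ENNReal.coe_mul, ENNReal.coe_inv four_ne_zero, ENNReal.coe_ofNat]
    _ ≤ ((S.M + 1) / 16 : ℝ≥0) * (#S.goodPoints / 2 ^ S.length) := by gcongr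
    _ ≤ _ := le_weakTypeConst_dyadicRotation
      (fun y => div_nonneg (S.spikeSum_nonneg y) zero_le_four) hmean (by positivity)
      (filter_subset _ _) fun _ => S.exists_lt_card_of_mem_goodPoints hv

lemma iSup_weakTypeConst_dyadicRotation :
    ⨆ J : ℕ, weakTypeConst (volume : Measure UnitAddCircle) (dyadicRotation J) = ∞ := by
  refine ENNReal.eq_top_of_forall_nnreal_le fun r => ?_
  obtain ⟨M, hM⟩ := exists_nat_ge (r * 64)
  obtain ⟨S, rfl, hK, hv⟩ := Scheme.exists_four_mul_length_succ_le M (2 ^ (M + 2))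
  refine le_iSup_of_le S.length (le_trans ?_ (S.le_weakTypeConst hK hv))
  rw [ENNReal.coe_le_coe, le_div_iff₀ (by norm_num)]
  exact hM.trans (le_add_of_nonneg_right zero_le_one)

end WeakType

end CountingProblem

/-- The supremum of the weak type (1,1) constants over all invertible measure preserving systems on
probability spaces is infinite, and it is infinite already over the dyadic rotations of the circle
with Lebesgue measure. -/
theorem theorem1 :
    (⨆ (X : Type) (_ : MeasurableSpace X) (μ : Measure X) (_ : IsProbabilityMeasure μ)
        (T : X ≃ᵐ X) (_ : MeasurePreserving T μ μ),
        CountingProblem.weakTypeConst μ T) = ∞ ∧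
      (⨆ J : ℕ, CountingProblem.weakTypeConst (volume : Measure UnitAddCircle)
        (CountingProblem.dyadicRotation J)) = ∞ := by
  refine ⟨?_, CountingProblem.iSup_weakTypeConst_dyadicRotation⟩
  rw [eq_top_iff, ← CountingProblem.iSup_weakTypeConst_dyadicRotation]
  refine iSup_le fun J => ?_
  exact le_iSup_of_le UnitAddCircle <| le_iSup_of_le inferInstance <|
    le_iSup_of_le (volume : Measure UnitAddCircle) <|
    le_iSup_of_le ⟨UnitAddCircle.measure_univ⟩ <|
    le_iSup_of_le (MeasurableEquiv.addRight ((((2 : ℝ) ^ J)⁻¹ : ℝ) : UnitAddCircle)) <|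
    le_iSup_of_le (measurePreserving_add_right volume _) le_rfl
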